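/- Let $p\neq 2,3$ be a prime and $R=\mathbb{Z}/p^2\mathbb{Z}$. For a ring $A$, let $V_A$ be the module of binary cubic forms $x(u,v)=x_1u^3+x_2u^2v+x_3uv^2+x_4v^3$ with coefficients in $A$, identified with $(x_1,x_2,x_3,x_4)$, on which $\mathrm{GL}_2(A)$ acts by $(g\cdot x)(u,v)=(\det g)^{-1}x(\alpha u+\gamma v,\beta u+\delta v)$ for $g=\begin{pmatrix}\alpha&\beta\\ \gamma&\delta\end{pmatrix}$. Let $V_R^*$ be the dual of $V_R$ with pairing $[x,y]=\sum_i x_iy_i$ in dual coordinates; since $3$ is invertible in $R$, $\iota(y_1,y_2,y_3,y_4)=(y_4,-3y_3,3y_2,-y_1)$ is a bijection by which $V_R^*$ is identified with $V_R$. For $f:V_R\to\mathbb{C}$ put $$\widehat f(y)=p^{-8}\sum_{a\in V_R}f(a)\exp\!\left(2\pi i\,[a,y]/p^2\right),\qquad y\in V_R^*,$$ and write $\widehat f(b)$ for $\widehat f(y)$ when $b=\iota(y)\in V_R$. A form over $\mathbb{F}_p$ is of type $(0)$ if it is zero. A nonzero form over $\mathbb{F}_p$ is of type $(3)$, $(21)$,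 $(111)$, $(1^21)$, $(1^3)$ if its roots in $\mathbb{P}^1(\mathbb{F}_p)$ are, respectively: none; exactly one, which is simple; three distinct ones; one double and one simple; one triple. Let $pR=\{pu: u\in R\}$ and $pR^\times=\{pu: u\in R^\times\}$. An element of $V_R$ is of type $(1^21_*)$, $(1^3_{\max})$, $(1^3_*)$, $(1^3_{**})$ if its $\mathrm{GL}_2(R)$-orbit contains some $(a_1,a_2,a_3,a_4)$ with, respectively: - $(1^21_*)$: $a_1=0$, $a_2\in R^\times$, $a_3\in pR$, $a_4=0$; - $(1^3_{\max})$: $a_1\in R^\times$, $a_2,a_3\in pR$, $a_4\in pR^\times$; - $(1^3_*)$: $a_1\in R^\times$, $a_2\in pR$, $a_3\in pR^\times$, $a_4=0$; - $(1^3_{**})$: $a_1\in R^\times$, $a_2\in pR$, $a_3=a_4=0$. Let $\Phi_p'$ be the indicator function of the set of elements of $V_R$ that lie in $pV_R$ or are of type $(1^3_{**})$, $(1^3_*)$, $(1^21_*)$ or $(1^3_{\max})$ (the forms that are nonmaximal or totally ramified at $p$). Then: (1) If $b=pb'\in pV_R$, where $b'$ is regarded as an element of $V_{\mathbb{F}_p}$,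 then $$\widehat{\Phi_p'}(pb')=\begin{cases}2p^{-2}-p^{-4}& b'\text{ of type }(0),\\ p^{-3}-p^{-4}& b'\text{ of type }(1^3),\\ 2p^{-3}-2p^{-4}& b'\text{ of type }(1^21),\\ 2p^{-3}-3p^{-4}& b'\text{ of type }(111),\\ -p^{-4}& b'\text{ of type }(21),\\ -p^{-3}& b'\text{ of type }(3).\end{cases}$$ (2) If $b\in V_R\setminus pV_R$, then $$\widehat{\Phi_p'}(b)=\begin{cases}p^{-3}-p^{-4}& b\text{ of type }(1^3_{**}),\\ -p^{-4}& b\text{ of type }(1^3_*),\\ 0&\text{otherwise.}\end{cases}$$ -/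

import Mathlib

namespace BinaryCubic

/-- Binary cubic forms `x(u,v) = x₀u³ + x₁u²v + x₂uv² + x₃v³` over `R`,
given by their four coefficients. -/
abbrev Form (R : Type*) := Fin 4 → R

/-- The value `x(u,v)` of a form. -/
def eval {R : Type*} [CommRing R] (x : Form R) (u v : R) : R :=
  x 0 * u ^ 3 + x 1 * u ^ 2 * v + x 2 * u * v ^ 2 + x 3 * v ^ 3

/-- The twisted action of `g = (α β; γ δ)` on forms,
`(g·x)(u,v) = (det g)⁻¹ x(αu + γv, βu + δv)`, in coordinates. -/
def act {R : Type*} [CommRing R] (g : GL (Fin 2) R) (x : Form R) : Form R :=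
  let α := g.val 0 0
  let β := g.val 0 1
  let γ := g.val 1 0
  let δ := g.val 1 1
  (((Matrix.GeneralLinearGroup.det g)⁻¹ : Rˣ) : R) •
    ![α ^ 3 * x 0 + α ^ 2 * β * x 1 + α * β ^ 2 * x 2 + β ^ 3 * x 3,
      3 * α ^ 2 * γ * x 0 + (α ^ 2 * δ + 2 * α * β * γ) * x 1
        + (β ^ 2 * γ + 2 * α * β * δ) * x 2 + 3 * β ^ 2 * δ * x 3,
      3 * α * γ ^ 2 * x 0 + (β * γ ^ 2 + 2 * α * γ * δ) * x 1
        + (α * δ ^ 2 + 2 * β * γ * δ) * x 2 + 3 * β * δ ^ 2 * x 3,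
      γ ^ 3 * x 0 + γ ^ 2 * δ * x 1 + γ * δ ^ 2 * x 2 + δ ^ 3 * x 3]

theorem eval_act {R : Type*} [CommRing R] (g : GL (Fin 2) R) (x : Form R) (u v : R) :
    eval (act g x) u v = (((Matrix.GeneralLinearGroup.det g)⁻¹ : Rˣ) : R) *
      eval x (g.val 0 0 * u + g.val 1 0 * v) (g.val 0 1 * u + g.val 1 1 * v) := by
  simp [eval, act]
  ring

/-- The `GL₂(R)`-saturation `GL₂(R) · D` of a set of forms. -/
def saturation {R : Type*} [CommRing R] (D : Set (Form R)) : Set (Form R) :=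
  {x | ∃ g : GL (Fin 2) R, ∃ d ∈ D, x = act g d}

/-! ### The dual space and the Fourier transform -/

/-- The map `ι : V* → V`, `(y₁,y₂,y₃,y₄) ↦ (y₄, -3y₃, 3y₂, -y₁)`, where the `yᵢ` are the
dual coordinates, that is, the values of `y` at the standard basis of `V`. -/
def iota {R : Type*} [CommRing R] (y : Module.Dual R (Form R)) : Form R :=
  ![y (Pi.single 3 1), -3 * y (Pi.single 2 1), 3 * y (Pi.single 1 1), -y (Pi.single 0 1)]

/-- If `3` is invertible, `ι` identifies `V*` with `V`. -/
theorem iota_bijective {R : Type*} [CommRing R] (h : IsUnit (3 : R)) :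
    Function.Bijective (iota : Module.Dual R (Form R) → Form R) := by
  obtain ⟨t, ht⟩ := h.exists_right_inv
  constructor
  · intro y z hyz
    have h0 := congrFun hyz 0
    have h1 := congrFun hyz 1
    have h2 := congrFun hyz 2
    have h3 := congrFun hyz 3
    simp only [iota, Matrix.cons_val] at h0 h1 h2 h3
    refine (Pi.basisFun R (Fin 4)).ext fun i => ?_
    rw [Pi.basisFun_apply]
    fin_cases i <;> simp only [Fin.zero_eta, Fin.mk_one, Fin.reduceFinMk]
    · simpa using h3
    · linear_combination t * h2 + (z (Pi.single 1 1) - y (Pi.single 1 1)) * ht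
    · linear_combination -t * h1 + (z (Pi.single 2 1) - y (Pi.single 2 1)) * ht
    · simpa using h0
  · intro b
    refine ⟨(Pi.basisFun R (Fin 4)).constr R ![-b 3, t * b 2, -t * b 1, b 0], ?_⟩
    have key : ∀ i, ((Pi.basisFun R (Fin 4)).constr R ![-b 3, t * b 2, -t * b 1, b 0])
        (Pi.single i 1) = ![-b 3, t * b 2, -t * b 1, b 0] i := fun i => by
      rw [← Pi.basisFun_apply, Module.Basis.constr_basis]
    funext i
    simp only [iota, key]
    fin_cases i
    · simp
    · simp
      linear_combination b 1 * ht
    · simp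
      linear_combination b 2 * ht
    · simp

/-- The finite Fourier transform
`f̂(y) = N⁻⁴ ∑ₐ f(a) exp(2πi [a,y]/N)` on `V* (ℤ/N)`, with `[a,y] = y(a)`;
`ZMod.stdAddChar` is the character `j ↦ exp(2πi j/N)` of `ℤ/N`. -/
noncomputable def fourier {N : ℕ} [NeZero N] (f : Form (ZMod N) → ℂ)
    (y : Module.Dual (ZMod N) (Form (ZMod N))) : ℂ :=
  (N : ℂ) ^ (-4 : ℤ) * ∑ a : Form (ZMod N), f a * ZMod.stdAddChar (y a)

theorem fourier_eq_exp {N : ℕ} [NeZero N] (f : Form (ZMod N) → ℂ)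
    (y : Module.Dual (ZMod N) (Form (ZMod N))) :
    fourier f y = (N : ℂ) ^ (-4 : ℤ) * ∑ a : Form (ZMod N),
      f a * Complex.exp (2 * Real.pi * Complex.I * ((y a).val : ℂ) / N) := by
  simp only [fourier, ZMod.stdAddChar_apply, ZMod.toCircle_apply]

/-! ### Types of forms over a field -/

/-- The multiplicity of a point of `ℙ¹(K)` as a root of the nonzero form `a`. The point `[s : 1]`
is written `s`, the point `[1 : 0]` is written `∞`. (The value for `a = 0` is `0`.) -/
noncomputable def rootMult {K : Type*} [Field K] (a : Form K) : OnePoint K → ℕ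
  | some s => (Polynomial.C (a 0) * Polynomial.X ^ 3 + Polynomial.C (a 1) * Polynomial.X ^ 2
      + Polynomial.C (a 2) * Polynomial.X + Polynomial.C (a 3)).rootMultiplicity s
  | none => (Polynomial.C (a 0) + Polynomial.C (a 1) * Polynomial.X
      + Polynomial.C (a 2) * Polynomial.X ^ 2
      + Polynomial.C (a 3) * Polynomial.X ^ 3).rootMultiplicity 0

/-- Type `(3)`: no rational root in `ℙ¹`. -/
def IsType3 {K : Type*} [Field K] (a : Form K) : Prop :=
  a ≠ 0 ∧ ∀ P, rootMult a P = 0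

/-- Type `(21)`: exactly one rational root in `ℙ¹`, and that root is simple. -/
def IsType21 {K : Type*} [Field K] (a : Form K) : Prop :=
  ∃ P, rootMult a P = 1 ∧ ∀ Q, Q ≠ P → rootMult a Q = 0

/-- Type `(111)`: three distinct rational roots. -/
def IsType111 {K : Type*} [Field K] (a : Form K) : Prop :=
  ∃ P Q R, P ≠ Q ∧ P ≠ R ∧ Q ≠ R ∧ rootMult a P = 1 ∧ rootMult a Q = 1 ∧ rootMult a R = 1

/-- Type `(1²1)`: one double and one simple rational root. -/
def IsType1sq1 {K : Type*} [Field K] (a : Form K) : Prop :=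
  ∃ P Q, P ≠ Q ∧ rootMult a P = 2 ∧ rootMult a Q = 1

/-- Type `(1³)`: one triple rational root. -/
def IsType1cu {K : Type*} [Field K] (a : Form K) : Prop :=
  ∃ P, rootMult a P = 3

/-! ### Types of forms over `ℤ/p²` -/

/-- Coefficientwise reduction modulo `p`. -/
def reduce (p : ℕ) (a : Form (ZMod (p ^ 2))) : Form (ZMod p) :=
  fun i => ZMod.castHom (dvd_pow_self p two_ne_zero) (ZMod p) (a i)

/-- `p V(ℤ/p²)`. -/
def pForms (p : ℕ) : Set (Form (ZMod (p ^ 2))) :=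
  {a | ∃ b : Form (ZMod (p ^ 2)), a = (p : ZMod (p ^ 2)) • b}

/-- `pR`, where `R = ℤ/p²`. -/
def pR (p : ℕ) : Set (ZMod (p ^ 2)) := {c | ∃ u, c = p * u}

/-- `pRˣ`, where `R = ℤ/p²`. -/
def pRUnits (p : ℕ) : Set (ZMod (p ^ 2)) := {c | ∃ u, IsUnit u ∧ c = p * u}

/-- Forms of type `(1²1_*)`. -/
def type1sq1Star (p : ℕ) : Set (Form (ZMod (p ^ 2))) :=
  saturation {a | a 0 = 0 ∧ IsUnit (a 1) ∧ a 2 ∈ pR p ∧ a 3 = 0}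

/-- Forms of type `(1³_max)`. -/
def type1cuMax (p : ℕ) : Set (Form (ZMod (p ^ 2))) :=
  saturation {a | IsUnit (a 0) ∧ a 1 ∈ pR p ∧ a 2 ∈ pR p ∧ a 3 ∈ pRUnits p}

/-- Forms of type `(1³_*)`. -/
def type1cuStar (p : ℕ) : Set (Form (ZMod (p ^ 2))) :=
  saturation {a | IsUnit (a 0) ∧ a 1 ∈ pR p ∧ a 2 ∈ pRUnits p ∧ a 3 = 0}

/-- Forms of type `(1³_**)`. -/
def type1cuStarStar (p : ℕ) : Set (Form (ZMod (p ^ 2))) :=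
  saturation {a | IsUnit (a 0) ∧ a 1 ∈ pR p ∧ a 2 = 0 ∧ a 3 = 0}

/-- The forms that are nonmaximal at `p`. -/
def nonmaximal (p : ℕ) : Set (Form (ZMod (p ^ 2))) :=
  pForms p ∪ type1cuStarStar p ∪ type1cuStar p ∪ type1sq1Star p

/-- `Φ'_p`, the indicator function of the forms that are nonmaximal or totally ramified at `p`. -/
noncomputable def PhiPrime (p : ℕ) : Form (ZMod (p ^ 2)) → ℂ :=
  (nonmaximal p ∪ type1cuMax p).indicator 1

end BinaryCubic

namespace BinaryCubic

/-! The support of `PhiPrime` is a union of sets indexed by the points `P` of the projective line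
over `ZMod p`, each built from coordinate subgroups. In coordinates with `P` at `[0 : 1]`, a form
counts as singular at `P` (`SingularAt`) when its coefficients lie in `(R, pR, pR, pR)` or in `(R,
R, pR, 0)`. A form outside `pV` lies in the support exactly when it is singular at some `P`
(`mem_support_iff`). That `P` is a multiple root modulo `p`, hence unique, since the root
multiplicities of a nonzero cubic add up to at most 3. A form in `pV` is singular at all `p + 1`
points. Hence `PhiPrime` is the sum over `P` of the singularity indicators minus `p` times the
indicator of `pV` (`PhiPrime_eq`).

By inclusion-exclusion each summand is a signed sum of indicators of products of subgroups, whose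
Fourier transforms are multiples of indicators of annihilators. Under `iota` the pairing becomes an
alternating form invariant under the change of coordinates at `P` (`sum_atPoint_mul_dualCoord`), so
the annihilators are read off from the coefficients of `b` at the same point `P`. This gives the
formula `fourier_PhiPrime`.

What remains is counting points. If `b = p b'` with `b'` nonzero modulo `p`, having `m` distinct
roots of which `n` are multiple, then `p ^ 8` times the transform is `m (p ^ 5 - p ^ 4) + n p ^ 5 -
p ^ 5`. If `b` is outside `pV`, only the points witnessing type `(1³_**)` or `(1³_*)` contribute. -/

/-- The form obtained from `x` by the substitution `u ↦ u + s v`. -/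
def shear {R : Type*} [CommRing R] (s : R) (x : Form R) : Form R :=
  ![x 0, 3 * s * x 0 + x 1, 3 * s ^ 2 * x 0 + 2 * s * x 1 + x 2,
    s ^ 3 * x 0 + s ^ 2 * x 1 + s * x 2 + x 3]

/-- The form obtained from `x` by the substitution `(u, v) ↦ (v, -u)`. -/
def rotate {R : Type*} [CommRing R] (x : Form R) : Form R :=
  ![-x 3, x 2, -x 1, x 0]

/-- The form `a` in coordinates in which the point `P` of the projective line is `[0 : 1]`. -/
def localForm {K : Type*} [CommRing K] (a : Form K) : OnePoint K → Form K
  | some s => shear s a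
  | none => rotate a

/-! ### Root multiplicities of binary cubic forms over a field -/

section Field

variable {K : Type*} [Field K]

theorem dehomogenize_ne_zero {a : Form K} (ha : a ≠ 0) :
    (Polynomial.C (a 0) * Polynomial.X ^ 3 + Polynomial.C (a 1) * Polynomial.X ^ 2
      + Polynomial.C (a 2) * Polynomial.X + Polynomial.C (a 3)) ≠ 0 := by
  intro h
  apply ha
  have hc := fun n => congrArg (fun f => Polynomial.coeff f n) h
  have h0 := hc 0
  have h1 := hc 1
  have h2 := hc 2
  have h3 := hc 3
  simp [Polynomial.coeff_X, Polynomial.coeff_C, Polynomial.coeff_X_pow] at h0 h1 h2 h3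
  funext i
  fin_cases i <;> simp [h0, h1, h2, h3]

theorem dehomogenize_infty_ne_zero {a : Form K} (ha : a ≠ 0) :
    (Polynomial.C (a 0) + Polynomial.C (a 1) * Polynomial.X
      + Polynomial.C (a 2) * Polynomial.X ^ 2
      + Polynomial.C (a 3) * Polynomial.X ^ 3) ≠ 0 := by
  intro h
  apply ha
  have hc := fun n => congrArg (fun f => Polynomial.coeff f n) h
  have h0 := hc 0
  have h1 := hc 1
  have h2 := hc 2
  have h3 := hc 3
  simp [Polynomial.coeff_X, Polynomial.coeff_C, Polynomial.coeff_X_pow] at h0 h1 h2 h3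
  funext i
  fin_cases i <;> simp [h0, h1, h2, h3]

theorem le_rootMult_infty_iff {a : Form K} (ha : a ≠ 0) (n : ℕ) :
    n ≤ rootMult a none ↔ ∀ d < n, (Polynomial.C (a 0) + Polynomial.C (a 1) * Polynomial.X
      + Polynomial.C (a 2) * Polynomial.X ^ 2
      + Polynomial.C (a 3) * Polynomial.X ^ 3).coeff d = 0 := by
  rw [rootMult, Polynomial.le_rootMultiplicity_iff (dehomogenize_infty_ne_zero ha), map_zero,
    sub_zero, Polynomial.X_pow_dvd_iff]

/-- Translating the root `s` to `0` turns divisibility by a power of `X - s` into vanishing of the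
lowest coefficients, and the translated polynomial has the coefficients of `shear s a`. -/
theorem le_rootMult_some_iff {a : Form K} (ha : a ≠ 0) (s : K) (n : ℕ) :
    n ≤ rootMult a (some s) ↔ ∀ d < n, (Polynomial.C (shear s a 0) * Polynomial.X ^ 3
      + Polynomial.C (shear s a 1) * Polynomial.X ^ 2
      + Polynomial.C (shear s a 2) * Polynomial.X + Polynomial.C (shear s a 3)).coeff d = 0 := by
  rw [rootMult, Polynomial.le_rootMultiplicity_iff (dehomogenize_ne_zero ha),
    Polynomial.X_sub_C_pow_dvd_iff, Polynomial.X_pow_dvd_iff]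
  have : (Polynomial.C (a 0) * Polynomial.X ^ 3 + Polynomial.C (a 1) * Polynomial.X ^ 2
      + Polynomial.C (a 2) * Polynomial.X + Polynomial.C (a 3)).comp
        (Polynomial.X + Polynomial.C s) = Polynomial.C (shear s a 0) * Polynomial.X ^ 3
      + Polynomial.C (shear s a 1) * Polynomial.X ^ 2
      + Polynomial.C (shear s a 2) * Polynomial.X + Polynomial.C (shear s a 3) := by
    simp [shear, map_ofNat Polynomial.C]
    ring
  rw [this]

theorem one_le_rootMult_iff {a : Form K} (ha : a ≠ 0) (P : OnePoint K) :
    1 ≤ rootMult a P ↔ localForm a P 3 = 0 := by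
  rcases P with _ | s
  · rw [le_rootMult_infty_iff ha]
    simp [localForm, rotate]
  · rw [le_rootMult_some_iff ha]
    simp [localForm]

theorem two_le_rootMult_iff {a : Form K} (ha : a ≠ 0) (P : OnePoint K) :
    2 ≤ rootMult a P ↔ localForm a P 2 = 0 ∧ localForm a P 3 = 0 := by
  have key (f : Polynomial K) : (∀ d < 2, f.coeff d = 0) ↔ f.coeff 1 = 0 ∧ f.coeff 0 = 0 :=
    ⟨fun h => ⟨h 1 (by norm_num), h 0 (by norm_num)⟩, fun h d hd => by
      interval_cases d
      exacts [h.2, h.1]⟩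
  rcases P with _ | s
  · rw [le_rootMult_infty_iff ha, key]
    simp [localForm, rotate, Polynomial.coeff_X_pow, Polynomial.coeff_X, Polynomial.coeff_C]
  · rw [le_rootMult_some_iff ha, key]
    simp [localForm, Polynomial.coeff_X_pow, Polynomial.coeff_X, Polynomial.coeff_C]

/-- A root at infinity of multiplicity `k` kills the `k` top coefficients of the dehomogenized
cubic, so its degree drops by at least `k`. -/
theorem natDegree_add_rootMult_infty_le {a : Form K} (ha : a ≠ 0) :
    (Polynomial.C (a 0) * Polynomial.X ^ 3 + Polynomial.C (a 1) * Polynomial.X ^ 2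
      + Polynomial.C (a 2) * Polynomial.X + Polynomial.C (a 3)).natDegree
      + rootMult a none ≤ 3 := by
  have h := (le_rootMult_infty_iff ha _).1 le_rfl
  set f := Polynomial.C (a 0) * Polynomial.X ^ 3 + Polynomial.C (a 1) * Polynomial.X ^ 2
      + Polynomial.C (a 2) * Polynomial.X + Polynomial.C (a 3) with hf
  have hle : f.natDegree ≤ 3 := by rw [hf]; compute_degree
  by_contra! hlt
  -- The two dehomogenizations list the coefficients in opposite orders, so this coefficient is the
  -- leading coefficient of `f`.
  have h0 := h (3 - f.natDegree) (by omega)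
  apply dehomogenize_ne_zero ha
  rw [← hf, ← Polynomial.leadingCoeff_eq_zero, Polynomial.leadingCoeff]
  generalize f.natDegree = n at *
  interval_cases n <;>
    simpa [hf, Polynomial.coeff_X_pow, Polynomial.coeff_X, Polynomial.coeff_C] using h0

theorem sum_rootMult_le [Fintype K] {a : Form K} (ha : a ≠ 0) (s : Finset (OnePoint K)) :
    ∑ P ∈ s, rootMult a P ≤ 3 := by
  classical
  let _ : Fintype (OnePoint K) := inferInstanceAs (Fintype (Option K))
  calc ∑ P ∈ s, rootMult a P ≤ ∑ P, rootMult a P := Finset.sum_le_univ_sum_of_nonneg (by simp)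
    _ = rootMult a none + ∑ t : K, rootMult a (some t) := Fintype.sum_option (rootMult a)
    _ ≤ 3 := by
      refine le_trans ?_ (natDegree_add_rootMult_infty_le ha)
      rw [add_comm]
      refine Nat.add_le_add_right ?_ _
      refine le_trans (le_of_eq ?_) (Polynomial.card_roots' _)
      simp only [rootMult, ← Polynomial.count_roots]
      exact Multiset.sum_count_eq_card (by simp)

theorem ne_zero_of_rootMult_ne_zero {a : Form K} {P : OnePoint K} (h : rootMult a P ≠ 0) :
    a ≠ 0 := by
  rintro rfl
  rcases P with _ | s <;> simp [rootMult] at h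

end Field


/-! ### The group action and its elementary matrices -/

section Action

variable {R : Type*} [CommRing R]

/-- The inverse of the determinant. -/
def detInv (g : GL (Fin 2) R) : R := (((Matrix.GeneralLinearGroup.det g)⁻¹ : Rˣ) : R)

theorem isUnit_detInv (g : GL (Fin 2) R) : IsUnit (detInv g) := Units.isUnit _

theorem act_apply (g : GL (Fin 2) R) (x : Form R) : act g x = detInv g •
    ![g.val 0 0 ^ 3 * x 0 + g.val 0 0 ^ 2 * g.val 0 1 * x 1 + g.val 0 0 * g.val 0 1 ^ 2 * x 2
        + g.val 0 1 ^ 3 * x 3,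
      3 * g.val 0 0 ^ 2 * g.val 1 0 * x 0
        + (g.val 0 0 ^ 2 * g.val 1 1 + 2 * g.val 0 0 * g.val 0 1 * g.val 1 0) * x 1
        + (g.val 0 1 ^ 2 * g.val 1 0 + 2 * g.val 0 0 * g.val 0 1 * g.val 1 1) * x 2
        + 3 * g.val 0 1 ^ 2 * g.val 1 1 * x 3,
      3 * g.val 0 0 * g.val 1 0 ^ 2 * x 0
        + (g.val 0 1 * g.val 1 0 ^ 2 + 2 * g.val 0 0 * g.val 1 0 * g.val 1 1) * x 1
        + (g.val 0 0 * g.val 1 1 ^ 2 + 2 * g.val 0 1 * g.val 1 0 * g.val 1 1) * x 2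
        + 3 * g.val 0 1 * g.val 1 1 ^ 2 * x 3,
      g.val 1 0 ^ 3 * x 0 + g.val 1 0 ^ 2 * g.val 1 1 * x 1 + g.val 1 0 * g.val 1 1 ^ 2 * x 2
        + g.val 1 1 ^ 3 * x 3] := rfl

theorem act_one (x : Form R) : act 1 x = x := by
  funext i
  fin_cases i <;> simp [act]

theorem act_act (g h : GL (Fin 2) R) (x : Form R) : act g (act h x) = act (g * h) x := by
  funext i
  fin_cases i <;> simp [act, Matrix.mul_apply, Fin.sum_univ_two] <;> ring

theorem mem_saturation_of_act_mem {D : Set (Form R)} {x : Form R} (g : GL (Fin 2) R)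
    (h : act g x ∈ saturation D) : x ∈ saturation D := by
  obtain ⟨k, d, hd, hx⟩ := h
  refine ⟨g⁻¹ * k, d, hd, ?_⟩
  rw [← act_act, ← hx, act_act, inv_mul_cancel, act_one]

theorem subset_saturation (D : Set (Form R)) : D ⊆ saturation D :=
  fun d hd => ⟨1, d, hd, (act_one d).symm⟩

/-- The element of `GL₂` inducing `shear s`. -/
def shearMatrix (s : R) : GL (Fin 2) R :=
  ⟨!![1, 0; s, 1], !![1, 0; -s, 1], by simp [Matrix.one_fin_two], by simp [Matrix.one_fin_two]⟩

/-- The element of `GL₂` inducing `rotate`. -/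
def rotateMatrix : GL (Fin 2) R :=
  ⟨!![0, -1; 1, 0], !![0, 1; -1, 0], by simp [Matrix.one_fin_two], by simp [Matrix.one_fin_two]⟩

theorem act_shearMatrix (s : R) (x : Form R) : act (shearMatrix s) x = shear s x := by
  funext i
  fin_cases i <;> simp [act, shearMatrix, shear]

theorem act_rotateMatrix (x : Form R) : act rotateMatrix x = rotate x := by
  funext i
  fin_cases i <;> simp [act, rotateMatrix, rotate, pow_succ]

end Action

/-! ### Reduction modulo `p` and orbit types in local coordinates -/

section Reduction

variable {p : ℕ}

/-- Reduction `ℤ/p² → ℤ/p`. -/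
def red (p : ℕ) : ZMod (p ^ 2) →+* ZMod p := ZMod.castHom (dvd_pow_self p two_ne_zero) (ZMod p)

theorem reduce_apply (a : Form (ZMod (p ^ 2))) (i : Fin 4) : reduce p a i = red p (a i) := rfl

/-- The lift of a residue class modulo `p` to `ℤ/p²`. -/
def liftZMod (s : ZMod p) : ZMod (p ^ 2) := (s.val : ZMod (p ^ 2))

theorem p_mul_p : (p : ZMod (p ^ 2)) * p = 0 := by
  rw [← Nat.cast_mul, ← pow_two, ZMod.natCast_self]

/-- An element of `SL₂(ℤ/p²)` moving the point `P` to `[0 : 1]` modulo `p`. -/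
def pointMatrix : OnePoint (ZMod p) → GL (Fin 2) (ZMod (p ^ 2))
  | some s => shearMatrix (liftZMod s)
  | none => rotateMatrix

/-- The form `a` in coordinates in which `P` is `[0 : 1]`. -/
def atPoint (P : OnePoint (ZMod p)) (a : Form (ZMod (p ^ 2))) : Form (ZMod (p ^ 2)) :=
  act (pointMatrix P) a

theorem atPoint_some (s : ZMod p) (a : Form (ZMod (p ^ 2))) :
    atPoint (some s) a = shear (liftZMod s) a := act_shearMatrix _ _

theorem atPoint_none (a : Form (ZMod (p ^ 2))) :
    atPoint none a = rotate a := act_rotateMatrix _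

theorem atPoint_smul (P : OnePoint (ZMod p)) (c : ZMod (p ^ 2)) (a : Form (ZMod (p ^ 2))) :
    atPoint P (c • a) = c • atPoint P a := by
  funext i
  fin_cases i <;> simp [atPoint, act] <;> ring

variable [hp : Fact p.Prime]

theorem red_liftZMod (s : ZMod p) : red p (liftZMod s) = s := by
  simp [liftZMod]

theorem red_p : red p p = 0 := by simp

theorem red_eq_zero_iff_exists {x : ZMod (p ^ 2)} : red p x = 0 ↔ ∃ u, x = p * u := by
  constructor
  · intro h
    have h2 : ((x.val : ℕ) : ZMod p) = 0 := by
      rw [← h, ← map_natCast (red p), ZMod.natCast_zmod_val]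
    obtain ⟨k, hk⟩ := (ZMod.natCast_eq_zero_iff _ _).1 h2
    exact ⟨k, by rw [← ZMod.natCast_zmod_val x, hk, Nat.cast_mul]⟩
  · rintro ⟨u, rfl⟩
    rw [map_mul, red_p, zero_mul]

theorem mem_pR_iff {x : ZMod (p ^ 2)} : x ∈ pR p ↔ red p x = 0 := red_eq_zero_iff_exists.symm

theorem p_mul_eq_zero_iff {x : ZMod (p ^ 2)} : (p : ZMod (p ^ 2)) * x = 0 ↔ red p x = 0 := by
  rw [red_eq_zero_iff_exists]
  constructor
  · intro h
    have h2 : ((p * x.val : ℕ) : ZMod (p ^ 2)) = 0 := by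
      rw [Nat.cast_mul, ZMod.natCast_zmod_val, h]
    have h3 : p * p ∣ p * x.val := by
      rw [ZMod.natCast_eq_zero_iff] at h2
      exact (dvd_of_eq (pow_two p).symm).trans h2
    obtain ⟨k, hk⟩ := Nat.dvd_of_mul_dvd_mul_left hp.out.pos h3
    exact ⟨k, by rw [← ZMod.natCast_zmod_val x, hk, Nat.cast_mul]⟩
  · rintro ⟨u, rfl⟩
    rw [← mul_assoc, p_mul_p, zero_mul]

theorem isUnit_iff_red_ne_zero {x : ZMod (p ^ 2)} : IsUnit x ↔ red p x ≠ 0 := by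
  rw [← ZMod.natCast_zmod_val x, ZMod.isUnit_iff_coprime, map_natCast, Ne,
    ZMod.natCast_eq_zero_iff, Nat.coprime_pow_right_iff two_pos, Nat.coprime_comm,
    hp.out.coprime_iff_not_dvd]

theorem mem_pRUnits_iff {x : ZMod (p ^ 2)} : x ∈ pRUnits p ↔ red p x = 0 ∧ x ≠ 0 := by
  constructor
  · rintro ⟨u, hu, rfl⟩
    refine ⟨by simp, fun h => ?_⟩
    exact isUnit_iff_red_ne_zero.1 hu (p_mul_eq_zero_iff.1 h)
  · rintro ⟨h, h0⟩
    obtain ⟨u, rfl⟩ := red_eq_zero_iff_exists.1 h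
    exact ⟨u, isUnit_iff_red_ne_zero.2 fun hu => h0 (p_mul_eq_zero_iff.2 hu), rfl⟩

/-- The ideal `pR` has square zero. This removes the error terms in the orbit computations below. -/
theorem mul_eq_zero_of_red {x y : ZMod (p ^ 2)} (hx : red p x = 0) (hy : red p y = 0) :
    x * y = 0 := by
  obtain ⟨u, rfl⟩ := red_eq_zero_iff_exists.1 hx
  rw [mul_assoc, mul_left_comm, p_mul_eq_zero_iff.2 hy, mul_zero]

theorem mem_pForms_iff {a : Form (ZMod (p ^ 2))} : a ∈ pForms p ↔ reduce p a = 0 := by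
  constructor
  · rintro ⟨b, rfl⟩
    funext i
    simp [reduce_apply]
  · intro h
    choose b hb using fun i => red_eq_zero_iff_exists.1 (congrFun h i : red p (a i) = 0)
    exact ⟨b, funext hb⟩

theorem reduce_atPoint (P : OnePoint (ZMod p)) (a : Form (ZMod (p ^ 2))) :
    reduce p (atPoint P a) = localForm (reduce p a) P := by
  rcases P with _ | s
  · funext i
    rw [atPoint_none]
    fin_cases i <;> simp [localForm, rotate, reduce_apply]
  · funext i
    rw [atPoint_some]
    fin_cases i <;> simp [localForm, shear, reduce_apply, red_liftZMod, map_ofNat (red p)]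

/-- The point matrices meet every coset of the subgroup of matrices upper triangular modulo `p`,
because these cosets correspond to points of the projective line over `ZMod p`. -/
theorem exists_pointMatrix_mul (g : GL (Fin 2) (ZMod (p ^ 2))) :
    ∃ P : OnePoint (ZMod p), red p ((pointMatrix P * g).val 1 0) = 0 := by
  by_cases h : red p (g.val 0 0) = 0
  · exact ⟨none, by simpa [pointMatrix, rotateMatrix, Matrix.mul_apply, Fin.sum_univ_two] using h⟩
  · refine ⟨some (-red p (g.val 1 0) / red p (g.val 0 0)), ?_⟩
    simp [pointMatrix, shearMatrix, Matrix.mul_apply, Fin.sum_univ_two, red_liftZMod]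
    field_simp
    ring

theorem red_diag_ne_zero {g : GL (Fin 2) (ZMod (p ^ 2))} (h : red p (g.val 1 0) = 0) :
    red p (g.val 0 0) ≠ 0 ∧ red p (g.val 1 1) ≠ 0 := by
  have hd := isUnit_iff_red_ne_zero.1 ((Matrix.isUnit_iff_isUnit_det _).1 g.isUnit)
  rw [Matrix.det_fin_two, map_sub, map_mul, map_mul, h, mul_zero, sub_zero] at hd
  exact mul_ne_zero_iff.1 hd

/-- A set of forms is Iwahori stable if it is preserved by the matrices that are upper triangular
modulo `p`. -/
def IwahoriStable (D : Set (Form (ZMod (p ^ 2)))) : Prop :=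
  ∀ g : GL (Fin 2) (ZMod (p ^ 2)), red p (g.val 1 0) = 0 → ∀ d ∈ D, act g d ∈ D

/-- Once a set is stable under the Iwahori subgroup, the quantifier over the whole group shrinks to
the finitely many points `P`. The set `E` may be larger than `D`, which allows a normalization such
as `a 0 = 0` to be dropped. -/
theorem mem_saturation_iff {D E : Set (Form (ZMod (p ^ 2)))} (hE : IwahoriStable E)
    (hDE : D ⊆ E) (hED : E ⊆ saturation D) (x : Form (ZMod (p ^ 2))) :
    x ∈ saturation D ↔ ∃ P : OnePoint (ZMod p), atPoint P x ∈ E := by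
  constructor
  · rintro ⟨g, d, hd, rfl⟩
    obtain ⟨P, hP⟩ := exists_pointMatrix_mul g
    refine ⟨P, ?_⟩
    rw [atPoint, act_act]
    exact hE _ hP d (hDE hd)
  · rintro ⟨P, hP⟩
    exact mem_saturation_of_act_mem _ (hED hP)

theorem mem_type1cuStarStar_iff (x : Form (ZMod (p ^ 2))) :
    x ∈ type1cuStarStar p ↔ ∃ P : OnePoint (ZMod p), red p (atPoint P x 0) ≠ 0 ∧
      red p (atPoint P x 1) = 0 ∧ atPoint P x 2 = 0 ∧ atPoint P x 3 = 0 := by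
  refine mem_saturation_iff (E := {a | red p (a 0) ≠ 0 ∧ red p (a 1) = 0 ∧ a 2 = 0 ∧ a 3 = 0})
    ?_ ?_ ?_ x
  · rintro g hg d ⟨h0, h1, h2, h3⟩
    obtain ⟨hα, hδ⟩ := red_diag_ne_zero hg
    have hdet := isUnit_iff_red_ne_zero.1 (isUnit_detInv g)
    -- With `γ` the lower left entry, `γ ^ 2` and `γ * d 1` vanish, and so the last two coefficients
    -- stay exactly zero.
    have hγ := mul_eq_zero_of_red hg hg
    have hγd := mul_eq_zero_of_red hg h1
    refine ⟨?_, ?_, ?_, ?_⟩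
    · simpa [act_apply, h1, h2, h3] using ⟨hdet, hα, h0⟩
    · simp [act_apply, h1, h2, h3, hg]
    · simp [act_apply, h2, h3]
      refine mul_eq_zero_of_right _ ?_
      linear_combination (3 * g.val 0 0 * d 0 + g.val 0 1 * d 1) * hγ
        + 2 * g.val 0 0 * g.val 1 1 * hγd
    · simp [act_apply, h2, h3]
      refine mul_eq_zero_of_right _ ?_
      linear_combination (g.val 1 0 * d 0 + g.val 1 1 * d 1) * hγ
  · rintro d ⟨h0, h1, h2, h3⟩
    exact ⟨isUnit_iff_red_ne_zero.1 h0, mem_pR_iff.1 h1, h2, h3⟩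
  · rintro d ⟨h0, h1, h2, h3⟩
    exact subset_saturation _ ⟨isUnit_iff_red_ne_zero.2 h0, mem_pR_iff.2 h1, h2, h3⟩

theorem mem_type1cuStar_iff (x : Form (ZMod (p ^ 2))) :
    x ∈ type1cuStar p ↔ ∃ P : OnePoint (ZMod p), red p (atPoint P x 0) ≠ 0 ∧
      red p (atPoint P x 1) = 0 ∧ (red p (atPoint P x 2) = 0 ∧ atPoint P x 2 ≠ 0) ∧
      atPoint P x 3 = 0 := by
  refine mem_saturation_iff (E := {a | red p (a 0) ≠ 0 ∧ red p (a 1) = 0 ∧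
    (red p (a 2) = 0 ∧ a 2 ≠ 0) ∧ a 3 = 0}) ?_ ?_ ?_ x
  · rintro g hg d ⟨h0, h1, ⟨h2, h2'⟩, h3⟩
    obtain ⟨hα, hδ⟩ := red_diag_ne_zero hg
    have hu := isUnit_detInv g
    have hdet := isUnit_iff_red_ne_zero.1 hu
    have hγ := mul_eq_zero_of_red hg hg
    have hγd := mul_eq_zero_of_red hg h1
    have hγe := mul_eq_zero_of_red hg h2
    refine ⟨?_, ?_, ⟨?_, ?_⟩, ?_⟩
    · simpa [act_apply, h1, h2, h3] using ⟨hdet, hα, h0⟩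
    · simp [act_apply, h1, h2, h3, hg]
    · simp [act_apply, h1, h2, h3, hg]
    -- All other contributions contain a product of two elements of `pR`, so `d 2` is only
    -- multiplied by a unit and stays nonzero.
    · have : act g d 2 = detInv g *
          (g.val 0 0 * g.val 1 1 ^ 2) * d 2 := by
        simp only [act_apply, h3, Pi.smul_apply, smul_eq_mul, Matrix.cons_val]
        linear_combination detInv g
          * ((3 * g.val 0 0 * d 0 + g.val 0 1 * d 1) * hγ
          + 2 * g.val 0 0 * g.val 1 1 * hγd + 2 * g.val 0 1 * g.val 1 1 * hγe)
      rw [this, Ne, IsUnit.mul_right_eq_zero]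
      · exact h2'
      · exact hu.mul ((isUnit_iff_red_ne_zero.2 hα).mul ((isUnit_iff_red_ne_zero.2 hδ).pow 2))
    · simp [act_apply, h3]
      refine mul_eq_zero_of_right _ ?_
      linear_combination (g.val 1 0 * d 0 + g.val 1 1 * d 1) * hγ + g.val 1 1 ^ 2 * hγe
  · rintro d ⟨h0, h1, h2, h3⟩
    exact ⟨isUnit_iff_red_ne_zero.1 h0, mem_pR_iff.1 h1, mem_pRUnits_iff.1 h2, h3⟩
  · rintro d ⟨h0, h1, h2, h3⟩
    exact subset_saturation _ ⟨isUnit_iff_red_ne_zero.2 h0, mem_pR_iff.2 h1,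
      mem_pRUnits_iff.2 h2, h3⟩

theorem mem_type1cuMax_iff (x : Form (ZMod (p ^ 2))) :
    x ∈ type1cuMax p ↔ ∃ P : OnePoint (ZMod p), red p (atPoint P x 0) ≠ 0 ∧
      red p (atPoint P x 1) = 0 ∧ red p (atPoint P x 2) = 0 ∧
      (red p (atPoint P x 3) = 0 ∧ atPoint P x 3 ≠ 0) := by
  refine mem_saturation_iff (E := {a | red p (a 0) ≠ 0 ∧ red p (a 1) = 0 ∧
    red p (a 2) = 0 ∧ (red p (a 3) = 0 ∧ a 3 ≠ 0)}) ?_ ?_ ?_ x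
  · rintro g hg d ⟨h0, h1, h2, h3, h3'⟩
    obtain ⟨hα, hδ⟩ := red_diag_ne_zero hg
    have hu := isUnit_detInv g
    have hdet := isUnit_iff_red_ne_zero.1 hu
    have hγ := mul_eq_zero_of_red hg hg
    have hγe := mul_eq_zero_of_red hg h2
    refine ⟨?_, ?_, ?_, ?_, ?_⟩
    · simpa [act_apply, h1, h2, h3] using ⟨hdet, hα, h0⟩
    · simp [act_apply, h1, h2, h3, hg]
    · simp [act_apply, h1, h2, h3, hg]
    · simp [act_apply, h1, h2, h3, hg]
    · have : act g d 3 = detInv g *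
          (g.val 1 1 ^ 3) * d 3 := by
        simp only [act_apply, Pi.smul_apply, smul_eq_mul, Matrix.cons_val]
        linear_combination detInv g
          * ((g.val 1 0 * d 0 + g.val 1 1 * d 1) * hγ + g.val 1 1 ^ 2 * hγe)
      rw [this, Ne, IsUnit.mul_right_eq_zero]
      · exact h3'
      · exact hu.mul ((isUnit_iff_red_ne_zero.2 hδ).pow 3)
  · rintro d ⟨h0, h1, h2, h3⟩
    exact ⟨isUnit_iff_red_ne_zero.1 h0, mem_pR_iff.1 h1, mem_pR_iff.1 h2, mem_pRUnits_iff.1 h3⟩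
  · rintro d ⟨h0, h1, h2, h3⟩
    exact subset_saturation _ ⟨isUnit_iff_red_ne_zero.2 h0, mem_pR_iff.2 h1,
      mem_pR_iff.2 h2, mem_pRUnits_iff.2 h3⟩

/-- The element of `GL₂` inducing the substitution `v ↦ v + s u`. -/
def upperMatrix {R : Type*} [CommRing R] (s : R) : GL (Fin 2) R :=
  ⟨!![1, s; 0, 1], !![1, -s; 0, 1], by simp [Matrix.one_fin_two], by simp [Matrix.one_fin_two]⟩

theorem mem_type1sq1Star_iff (x : Form (ZMod (p ^ 2))) :
    x ∈ type1sq1Star p ↔ ∃ P : OnePoint (ZMod p), red p (atPoint P x 1) ≠ 0 ∧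
      red p (atPoint P x 2) = 0 ∧ atPoint P x 3 = 0 := by
  refine mem_saturation_iff (E := {a | red p (a 1) ≠ 0 ∧ red p (a 2) = 0 ∧ a 3 = 0}) ?_ ?_ ?_ x
  · rintro g hg d ⟨h1, h2, h3⟩
    obtain ⟨hα, hδ⟩ := red_diag_ne_zero hg
    have hdet := isUnit_iff_red_ne_zero.1 (isUnit_detInv g)
    have hγ := mul_eq_zero_of_red hg hg
    have hγe := mul_eq_zero_of_red hg h2
    refine ⟨?_, ?_, ?_⟩
    · simpa [act_apply, h2, h3, hg] using ⟨hdet, ⟨hα, hδ⟩, h1⟩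
    · simp [act_apply, h2, h3, hg]
    · simp [act_apply, h3]
      refine mul_eq_zero_of_right _ ?_
      linear_combination (g.val 1 0 * d 0 + g.val 1 1 * d 1) * hγ + g.val 1 1 ^ 2 * hγe
  · rintro d ⟨h0, h1, h2, h3⟩
    exact ⟨isUnit_iff_red_ne_zero.1 h1, mem_pR_iff.1 h2, h3⟩
  · rintro d ⟨h1, h2, h3⟩
    obtain ⟨c, hc⟩ := (isUnit_iff_red_ne_zero.2 h1).exists_right_inv
    have h22 := mul_eq_zero_of_red h2 h2
    -- The substitution `v ↦ v + s u` must solve `d 0 + s * d 1 + s ^ 2 * d 2 = 0`. The first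
    -- approximation is `s = -d 0 * c`, where `c` inverts `d 1`. One correction of its error `d 2 *
    -- d 0 ^ 2 * c ^ 2` gives an exact root because `d 2 ^ 2 = 0`.
    apply mem_saturation_of_act_mem (upperMatrix (-d 0 * c - d 2 * d 0 ^ 2 * c ^ 3))
    apply subset_saturation
    refine ⟨?_, ?_, ?_, ?_⟩
    · simp only [act, upperMatrix, h3]
      simp
      linear_combination (-d 0 - d 2 * d 0 ^ 2 * c ^ 2) * hc
        + (2 * d 0 ^ 3 * c ^ 4 + d 2 * d 0 ^ 4 * c ^ 6) * h22
    · rw [isUnit_iff_red_ne_zero]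
      simpa [act, upperMatrix, h2, h3] using h1
    · rw [mem_pR_iff]
      simp [act, upperMatrix, h2, h3]
    · simp [act, upperMatrix, h3]

/-! ### The support of `PhiPrime` as a sum over points -/

/-- `atPoint P a` lies in `(R, pR, pR, pR) ∪ (R, R, pR, 0)`. -/
def SingularAt (a : Form (ZMod (p ^ 2))) (P : OnePoint (ZMod p)) : Prop :=
  red p (atPoint P a 2) = 0 ∧
    (red p (atPoint P a 1) = 0 ∧ red p (atPoint P a 3) = 0 ∨ atPoint P a 3 = 0)

theorem atPoint_ne_zero {a : Form (ZMod (p ^ 2))} (ha : a ∉ pForms p) (P : OnePoint (ZMod p))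
    (h1 : red p (atPoint P a 1) = 0) (h2 : red p (atPoint P a 2) = 0)
    (h3 : red p (atPoint P a 3) = 0) : red p (atPoint P a 0) ≠ 0 := by
  intro h0
  apply ha
  have h : atPoint P a ∈ pForms p := by
    rw [mem_pForms_iff]
    funext i
    fin_cases i <;> assumption
  obtain ⟨b, hb⟩ := h
  refine ⟨act (pointMatrix P)⁻¹ b, ?_⟩
  have : a = act (pointMatrix P)⁻¹ (atPoint P a) := by
    rw [atPoint, act_act, inv_mul_cancel, act_one]
  rw [this, hb]
  funext i
  fin_cases i <;> simp [act] <;> ring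

/-- At a fixed `P` the four types partition the singular forms outside `pV`: first by whether
coefficient 1 is a unit, then by whether coefficients 3 and 2 vanish exactly. When coefficient 1 is
not a unit, coefficient 0 must be one by `atPoint_ne_zero`. -/
theorem mem_support_iff {a : Form (ZMod (p ^ 2))} (ha : a ∉ pForms p) :
    a ∈ nonmaximal p ∪ type1cuMax p ↔ ∃ P, SingularAt a P := by
  simp only [nonmaximal, Set.mem_union, ha, false_or, mem_type1cuStarStar_iff,
    mem_type1cuStar_iff, mem_type1cuMax_iff, mem_type1sq1Star_iff, ← exists_or, SingularAt]
  refine exists_congr fun P => ?_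
  have h := atPoint_ne_zero ha P
  constructor
  · rintro (((⟨h0, h1, h2, h3⟩ | ⟨h0, h1, h2, h3⟩) | ⟨h1, h2, h3⟩) | ⟨h0, h1, h2, h3⟩)
    · exact ⟨by rw [h2, map_zero], Or.inr h3⟩
    · exact ⟨h2.1, Or.inr h3⟩
    · exact ⟨h2, Or.inr h3⟩
    · exact ⟨h2, Or.inl ⟨h1, h3.1⟩⟩
  · rintro ⟨h2, h3⟩
    have hr : red p (atPoint P a 3) = 0 := by
      rcases h3 with h3 | h3
      · exact h3.2
      · rw [h3, map_zero]
    by_cases h1 : red p (atPoint P a 1) = 0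
    · have h0 := h h1 h2 hr
      by_cases h3' : atPoint P a 3 = 0
      · by_cases h2' : atPoint P a 2 = 0
        · exact Or.inl (Or.inl (Or.inl ⟨h0, h1, h2', h3'⟩))
        · exact Or.inl (Or.inl (Or.inr ⟨h0, h1, ⟨h2, h2'⟩, h3'⟩))
      · exact Or.inr ⟨h0, h1, h2, hr, h3'⟩
    · exact Or.inl (Or.inr ⟨h1, h2, h3.resolve_left fun h => h1 h.1⟩)

theorem SingularAt.two_le_rootMult {a : Form (ZMod (p ^ 2))} (ha : a ∉ pForms p)
    {P : OnePoint (ZMod p)} (h : SingularAt a P) : 2 ≤ rootMult (reduce p a) P := by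
  rw [mem_pForms_iff] at ha
  rw [two_le_rootMult_iff ha, ← reduce_atPoint]
  refine ⟨h.1, ?_⟩
  rcases h.2 with h3 | h3
  · exact h3.2
  · rw [reduce_apply, h3, map_zero]

theorem eq_of_two_le_rootMult {K : Type*} [Field K] [Fintype K] {a : Form K} {P Q : OnePoint K}
    (hP : 2 ≤ rootMult a P) (hQ : 2 ≤ rootMult a Q) : P = Q := by
  classical
  by_contra h
  have := sum_rootMult_le (ne_zero_of_rootMult_ne_zero (by omega : rootMult a P ≠ 0)) {P, Q}
  rw [Finset.sum_pair h] at this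
  omega

instance fintypeOnePoint {K : Type*} [Fintype K] : Fintype (OnePoint K) :=
  inferInstanceAs (Fintype (Option K))

-- Outside `pV` at most one `P` contributes, being a multiple root modulo `p`. On `pV` every point
-- contributes, and the correction leaves `(p + 1) - p = 1`.
open Classical in
theorem PhiPrime_eq (a : Form (ZMod (p ^ 2))) :
    PhiPrime p a = (∑ P : OnePoint (ZMod p), if SingularAt a P then (1 : ℂ) else 0)
      - p * (if a ∈ pForms p then 1 else 0) := by
  by_cases ha : a ∈ pForms p
  · have hs : ∀ P : OnePoint (ZMod p), SingularAt a P := by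
      intro P
      obtain ⟨b, rfl⟩ := ha
      rw [SingularAt, atPoint_smul]
      simp
    have : a ∈ nonmaximal p ∪ type1cuMax p := by simp [nonmaximal, ha]
    have hc : Fintype.card (OnePoint (ZMod p)) = p + 1 :=
      (Fintype.card_option (α := ZMod p)).trans (by rw [ZMod.card])
    simp [PhiPrime, this, ha, hs, hc]
  · rw [if_neg ha, mul_zero, sub_zero]
    by_cases h : ∃ P, SingularAt a P
    · rw [PhiPrime, Set.indicator_of_mem ((mem_support_iff ha).2 h)]
      obtain ⟨P, hP⟩ := h
      rw [Finset.sum_eq_single P]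
      · simp [hP]
      · intro Q _ hQ
        rw [if_neg]
        intro hQ'
        exact hQ (eq_of_two_le_rootMult (hQ'.two_le_rootMult ha) (hP.two_le_rootMult ha))
      · simp
    · rw [PhiPrime, Set.indicator_of_notMem (mt (mem_support_iff ha).1 h)]
      push Not at h
      simp [h]

end Reduction


/-! ### Character sums over subgroups -/

section CharacterSums

theorem forall_fin_four {q : Fin 4 → Prop} : (∀ i, q i) ↔ q 0 ∧ q 1 ∧ q 2 ∧ q 3 :=
  ⟨fun h => ⟨h 0, h 1, h 2, h 3⟩, fun h i => by
    fin_cases i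
    exacts [h.1, h.2.1, h.2.2.1, h.2.2.2]⟩

-- Orthogonality: a nontrivial character sums to zero over a finite group. Since the standard
-- character is injective, `x ↦ ψ(x c)` is trivial on `J` only if `c` annihilates `J`.
open Classical in
theorem sum_addSubgroup_stdAddChar {N : ℕ} [NeZero N] (J : AddSubgroup (ZMod N)) (c : ZMod N) :
    ∑ x, (if x ∈ J then (ZMod.stdAddChar (x * c) : ℂ) else 0)
      = if ∀ x ∈ J, x * c = 0 then (Nat.card J : ℂ) else 0 := by
  let ψ : AddChar J ℂ :=
    (ZMod.stdAddChar (N := N)).compAddMonoidHom ((AddMonoidHom.mulRight c).comp J.subtype)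
  have h1 : ∑ x, (if x ∈ J then (ZMod.stdAddChar (x * c) : ℂ) else 0) = ∑ x : J, ψ x := by
    rw [← Finset.sum_filter]
    exact Finset.sum_subtype _ (by simp) _
  have h2 : ψ = 0 ↔ ∀ x ∈ J, x * c = 0 := by
    constructor
    · intro h x hx
      have h3 : ZMod.stdAddChar (x * c) = 1 := DFunLike.congr_fun h (⟨x, hx⟩ : J)
      exact ZMod.injective_stdAddChar (h3.trans (AddChar.map_zero_eq_one _).symm)
    · intro h
      ext x
      change ZMod.stdAddChar ((x : ZMod N) * c) = 1
      rw [h x x.2, AddChar.map_zero_eq_one]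
  rw [h1, AddChar.sum_eq_ite, Nat.card_eq_fintype_card]
  simp only [h2]

open Classical in
theorem sum_pi_stdAddChar {N : ℕ} [NeZero N] (J : Fin 4 → AddSubgroup (ZMod N))
    (c : Form (ZMod N)) :
    ∑ x : Form (ZMod N), (if ∀ i, x i ∈ J i then (1 : ℂ) else 0)
        * ZMod.stdAddChar (∑ i, x i * c i)
      = ∏ i, if ∀ x ∈ J i, x * c i = 0 then (Nat.card (J i) : ℂ) else 0 := by
  simp only [← sum_addSubgroup_stdAddChar]
  rw [Finset.prod_univ_sum, Fintype.piFinset_univ]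
  refine Finset.sum_congr rfl fun x _ => ?_
  have h : (ZMod.stdAddChar (∑ i, x i * c i) : ℂ) = ∏ i, ZMod.stdAddChar (x i * c i) := by
    simp only [Fin.sum_univ_four, Fin.prod_univ_four, AddChar.map_add_eq_mul]
  rw [Finset.prod_ite_zero, h]
  simp

end CharacterSums

/-! ### The Fourier transform of `PhiPrime` as a sum over points -/

section Transform

variable {p : ℕ}

theorem top_annihilator {c : ZMod (p ^ 2)} :
    (∀ x ∈ (⊤ : AddSubgroup (ZMod (p ^ 2))), x * c = 0) ↔ c = 0 :=
  ⟨fun h => by simpa using h 1 trivial, fun h x _ => by rw [h, mul_zero]⟩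

/-- The dual coordinates of `ι⁻¹ b`, where `t` is the inverse of `3`. -/
def dualCoord {R : Type*} [CommRing R] (t : R) (b : Form R) : Form R :=
  ![-b 3, t * b 2, -t * b 1, b 0]

theorem dual_apply {R : Type*} [CommRing R] {t : R} (ht : 3 * t = 1)
    (y : Module.Dual R (Form R)) (a : Form R) : y a = ∑ i, a i * dualCoord t (iota y) i := by
  have h : y a = ∑ i, a i * y (Pi.single i 1) := by
    conv_lhs => rw [pi_eq_sum_univ' a, map_sum]
    refine Finset.sum_congr rfl fun i _ => ?_
    rw [map_smul, smul_eq_mul]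
  rw [h]
  simp [Fin.sum_univ_four, dualCoord, iota]
  linear_combination (-a 1 * y (Pi.single 1 1) - a 2 * y (Pi.single 2 1)) * ht

/-- Through `iota` the pairing becomes the alternating form on binary cubics, which is invariant
under `SL₂`, and the point matrices have determinant one. -/
theorem sum_atPoint_mul_dualCoord {t : ZMod (p ^ 2)} (ht : 3 * t = 1) (P : OnePoint (ZMod p))
    (a b : Form (ZMod (p ^ 2))) :
    ∑ i, atPoint P a i * dualCoord t (atPoint P b) i = ∑ i, a i * dualCoord t b i := by
  rcases P with _ | s
  · simp [atPoint_none, rotate, dualCoord, Fin.sum_univ_four]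
    ring
  · simp [atPoint_some, shear, dualCoord, Fin.sum_univ_four]
    generalize liftZMod s = s
    linear_combination (s * a 0 * b 2 + s ^ 2 * a 0 * b 1 - s * b 0 * a 2 - s ^ 2 * b 0 * a 1) * ht

variable [hp : Fact p.Prime]

/-- The kernel of reduction modulo `p`. -/
def redKer (p : ℕ) : AddSubgroup (ZMod (p ^ 2)) := (red p : ZMod (p ^ 2) →+ ZMod p).ker

theorem mem_redKer {x : ZMod (p ^ 2)} : x ∈ redKer p ↔ red p x = 0 := Iff.rfl

theorem card_redKer : Nat.card (redKer p) = p := by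
  have h := AddSubgroup.card_mul_index (redKer p)
  have h2 : (red p : ZMod (p ^ 2) →+ ZMod p).range = ⊤ :=
    AddMonoidHom.range_eq_top.2 fun s => ⟨liftZMod s, red_liftZMod s⟩
  rw [redKer, AddSubgroup.index_ker, h2, AddSubgroup.card_top, Nat.card_zmod, Nat.card_zmod] at h
  exact Nat.eq_of_mul_eq_mul_right hp.out.pos (h.trans (pow_two p))

theorem redKer_annihilator {c : ZMod (p ^ 2)} : (∀ x ∈ redKer p, x * c = 0) ↔ red p c = 0 :=
  ⟨fun h => p_mul_eq_zero_iff.1 (h _ (mem_redKer.2 red_p)),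
    fun h _ hx => mul_eq_zero_of_red (mem_redKer.1 hx) h⟩

theorem isUnit_three (hp3 : p ≠ 3) : IsUnit (3 : ZMod (p ^ 2)) := by
  rw [isUnit_iff_red_ne_zero, map_ofNat]
  intro h
  have h3 : ((3 : ℕ) : ZMod p) = 0 := by exact_mod_cast h
  rw [ZMod.natCast_eq_zero_iff, Nat.prime_dvd_prime_iff_eq hp.out Nat.prime_three] at h3
  exact hp3 h3

/-- `atPoint P` as a bijection. -/
def atPointEquiv (P : OnePoint (ZMod p)) : Form (ZMod (p ^ 2)) ≃ Form (ZMod (p ^ 2)) where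
  toFun := atPoint P
  invFun := act (pointMatrix P)⁻¹
  left_inv a := by rw [atPoint, act_act, inv_mul_cancel, act_one]
  right_inv a := by rw [atPoint, act_act, mul_inv_cancel, act_one]

open Classical in
theorem sum_atPoint_mem {t : ZMod (p ^ 2)} (ht : 3 * t = 1)
    (y : Module.Dual (ZMod (p ^ 2)) (Form (ZMod (p ^ 2)))) (P : OnePoint (ZMod p))
    (J : Fin 4 → AddSubgroup (ZMod (p ^ 2))) :
    ∑ a, (if ∀ i, atPoint P a i ∈ J i then (1 : ℂ) else 0) * ZMod.stdAddChar (y a)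
      = ∏ i, if ∀ x ∈ J i, x * dualCoord t (atPoint P (iota y)) i = 0
          then (Nat.card (J i) : ℂ) else 0 := by
  rw [← sum_pi_stdAddChar, ← Equiv.sum_comp (atPointEquiv P)
    (fun x => (if ∀ i, x i ∈ J i then (1 : ℂ) else 0) * _)]
  refine Finset.sum_congr rfl fun a _ => ?_
  have h : atPointEquiv P a = atPoint P a := rfl
  rw [h, sum_atPoint_mul_dualCoord ht, dual_apply ht]

open Classical in
theorem fourier_PhiPrime (hp3 : p ≠ 3) (y : Module.Dual (ZMod (p ^ 2)) (Form (ZMod (p ^ 2)))) :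
    (p : ℂ) ^ 8 * fourier (PhiPrime p) y =
      (∑ P : OnePoint (ZMod p),
        ((if red p (atPoint P (iota y) 0) = 0 ∧ red p (atPoint P (iota y) 1) = 0 ∧
            red p (atPoint P (iota y) 2) = 0 ∧ atPoint P (iota y) 3 = 0 then (p : ℂ) ^ 5 else 0)
        + (if red p (atPoint P (iota y) 1) = 0 ∧
            atPoint P (iota y) 2 = 0 ∧ atPoint P (iota y) 3 = 0 then (p : ℂ) ^ 5 else 0)
        - (if red p (atPoint P (iota y) 1) = 0 ∧
            red p (atPoint P (iota y) 2) = 0 ∧ atPoint P (iota y) 3 = 0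
            then (p : ℂ) ^ 4 else 0)))
      - if iota y ∈ pForms p then (p : ℂ) ^ 5 else 0 := by
  have hu := isUnit_three hp3
  obtain ⟨t, ht⟩ := hu.exists_right_inv
  have hut : IsUnit t := IsUnit.of_mul_eq_one_right _ ht
  have hrt : red p t ≠ 0 := isUnit_iff_red_ne_zero.1 hut
  have hp0 : (p : ℂ) ≠ 0 := Nat.cast_ne_zero.2 hp.out.ne_zero
  -- Inclusion-exclusion: the third product of subgroups is the intersection of the first two.
  have hsing (a : Form (ZMod (p ^ 2))) (P : OnePoint (ZMod p)) :
      (if SingularAt a P then (1 : ℂ) else 0)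
      = (if ∀ i, atPoint P a i ∈ (![⊤, redKer p, redKer p, redKer p] :
            Fin 4 → AddSubgroup (ZMod (p ^ 2))) i then 1 else 0)
      + (if ∀ i, atPoint P a i ∈ (![⊤, ⊤, redKer p, ⊥] :
            Fin 4 → AddSubgroup (ZMod (p ^ 2))) i then 1 else 0)
      - (if ∀ i, atPoint P a i ∈ (![⊤, redKer p, redKer p, ⊥] :
            Fin 4 → AddSubgroup (ZMod (p ^ 2))) i then 1 else 0) := by
    simp only [SingularAt, forall_fin_four, mem_redKer, Matrix.cons_val,
      AddSubgroup.mem_bot, AddSubgroup.mem_top]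
    by_cases h3' : atPoint P a 3 = 0
    · by_cases h1 : red p (atPoint P a 1) = 0 <;> by_cases h2 : red p (atPoint P a 2) = 0 <;>
        simp [h1, h2, h3']
    · by_cases h1 : red p (atPoint P a 1) = 0 <;> by_cases h2 : red p (atPoint P a 2) = 0 <;>
        by_cases h3 : red p (atPoint P a 3) = 0 <;> simp [h1, h2, h3, h3']
  have hpF (a : Form (ZMod (p ^ 2))) : (if a ∈ pForms p then (1 : ℂ) else 0)
      = if ∀ i, a i ∈ (fun _ => redKer p : Fin 4 → AddSubgroup (ZMod (p ^ 2))) i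
        then 1 else 0 := by
    simp only [mem_pForms_iff, funext_iff, mem_redKer]
    rfl
  have hbot : Nat.card (⊥ : AddSubgroup (ZMod (p ^ 2))) = 1 := AddSubgroup.card_bot
  have hcard : (Nat.card (⊤ : AddSubgroup (ZMod (p ^ 2))) : ℂ) = (p : ℂ) ^ 2 := by
    rw [AddSubgroup.card_top, Nat.card_zmod, Nat.cast_pow]
  have hE (P : OnePoint (ZMod p)) := sum_atPoint_mem ht y P ![⊤, redKer p, redKer p, redKer p]
  have hD (P : OnePoint (ZMod p)) := sum_atPoint_mem ht y P ![⊤, ⊤, redKer p, ⊥]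
  have hDE (P : OnePoint (ZMod p)) := sum_atPoint_mem ht y P ![⊤, redKer p, redKer p, ⊥]
  have hV := sum_pi_stdAddChar (fun _ => redKer p) (dualCoord t (iota y))
  simp only [← dual_apply ht] at hV
  have hmain : (p : ℂ) ^ 8 * fourier (PhiPrime p) y
      = (∑ P, ∑ a, (if SingularAt a P then (1 : ℂ) else 0) * ZMod.stdAddChar (y a))
        - p * ∑ a, (if a ∈ pForms p then (1 : ℂ) else 0) * ZMod.stdAddChar (y a) := by
    rw [Finset.sum_comm, Finset.mul_sum, ← Finset.sum_sub_distrib, fourier, ← mul_assoc]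
    have : (p : ℂ) ^ 8 * ((p ^ 2 : ℕ) : ℂ) ^ (-4 : ℤ) = 1 := by
      push_cast
      rw [zpow_neg, zpow_ofNat, ← pow_mul]
      exact mul_inv_cancel₀ (pow_ne_zero _ hp0)
    rw [this, one_mul]
    refine Finset.sum_congr rfl fun a _ => ?_
    rw [PhiPrime_eq, sub_mul, Finset.sum_mul, mul_assoc]
  rw [hmain]
  congr 1
  · refine Finset.sum_congr rfl fun P _ => ?_
    simp only [hsing, sub_mul, add_mul, Finset.sum_sub_distrib, Finset.sum_add_distrib]
    rw [hE, hD, hDE]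
    simp only [Fin.prod_univ_four, Matrix.cons_val, hcard, hbot]
    simp only [redKer_annihilator, top_annihilator, Matrix.cons_val, card_redKer,
      dualCoord, map_mul, map_neg, neg_eq_zero, mul_eq_zero, hrt, false_or,
      AddSubgroup.mem_bot, forall_eq, zero_mul, Nat.cast_one, if_true, neg_mul,
      hut.mul_right_eq_zero]
    simp only [ite_zero_mul_ite_zero, mul_one]
    -- The powers of `p` are the orders of the subgroups: `2+1+1+1`, `2+2+1+0` and `2+1+1+0` in the
    -- exponent. The dual coordinates come in reverse order, so the full first factor forces the
    -- last coefficient of `iota y` to vanish.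
    refine congrArg₂ _ (congrArg₂ _ ?_ ?_) ?_ <;> exact if_congr (by tauto) (by ring) rfl
  · have hV' : ∑ a, (if a ∈ pForms p then (1 : ℂ) else 0) * ZMod.stdAddChar (y a) = _ :=
      (Finset.sum_congr rfl fun a _ => by rw [hpF]).trans hV
    rw [hV']
    simp only [Fin.prod_univ_four, redKer_annihilator, card_redKer, dualCoord, Matrix.cons_val,
      map_mul, map_neg, neg_eq_zero, mul_eq_zero, hrt, false_or, neg_mul]
    simp only [mem_pForms_iff, funext_iff, forall_fin_four, reduce_apply, Pi.zero_apply]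
    by_cases h0 : red p (iota y 0) = 0 <;> by_cases h1 : red p (iota y 1) = 0 <;>
      by_cases h2 : red p (iota y 2) = 0 <;> by_cases h3 : red p (iota y 3) = 0 <;>
      simp [h0, h1, h2, h3]
    ring

end Transform


/-! ### Numbers of roots and multiple roots for each type over a field -/

section Counting

variable {K : Type*} [Field K] [Fintype K]

theorem rootMult_add_le {a : Form K} (ha : a ≠ 0) {P Q : OnePoint K} (h : P ≠ Q) :
    rootMult a P + rootMult a Q ≤ 3 := by
  classical
  simpa [Finset.sum_pair h] using sum_rootMult_le ha {P, Q}

theorem rootMult_add_add_le {a : Form K} (ha : a ≠ 0) {P Q R : OnePoint K} (h : P ≠ Q)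
    (h1 : P ≠ R) (h2 : Q ≠ R) : rootMult a P + (rootMult a Q + rootMult a R) ≤ 3 := by
  classical
  simpa [Finset.sum_insert, h, h1, h2] using sum_rootMult_le ha {P, Q, R}

theorem rootMult_add_add_add_le {a : Form K} (ha : a ≠ 0) {P Q R S : OnePoint K} (h : P ≠ Q)
    (h1 : P ≠ R) (h2 : Q ≠ R) (hP : S ≠ P) (hQ : S ≠ Q) (hR : S ≠ R) :
    rootMult a S + (rootMult a P + (rootMult a Q + rootMult a R)) ≤ 3 := by
  classical
  simpa [Finset.sum_insert, h, h1, h2, hP, hQ, hR] using sum_rootMult_le ha {S, P, Q, R}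

/-- The points of multiplicity at least `n`. -/
noncomputable def rootsOfMult (a : Form K) (n : ℕ) : Finset (OnePoint K) := by
  classical exact Finset.univ.filter fun P => n ≤ rootMult a P

theorem mem_rootsOfMult {a : Form K} {n : ℕ} {P : OnePoint K} :
    P ∈ rootsOfMult a n ↔ n ≤ rootMult a P := by simp [rootsOfMult]

theorem IsType1cu.card {a : Form K} (h : IsType1cu a) :
    a ≠ 0 ∧ (rootsOfMult a 1).card = 1 ∧ (rootsOfMult a 2).card = 1 := by
  obtain ⟨P, hP⟩ := h
  have ha : a ≠ 0 := ne_zero_of_rootMult_ne_zero (P := P) (by omega)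
  have key (n : ℕ) (hn : 1 ≤ n) (hn' : n ≤ 3) : (rootsOfMult a n).card = 1 := by
    rw [Finset.card_eq_one]
    refine ⟨P, Finset.ext fun Q => ?_⟩
    rw [mem_rootsOfMult, Finset.mem_singleton]
    constructor
    · intro hQ
      by_contra h
      have := rootMult_add_le ha h
      omega
    · rintro rfl
      omega
  exact ⟨ha, key 1 (by norm_num) (by norm_num), key 2 (by norm_num) (by norm_num)⟩

theorem IsType1sq1.card {a : Form K} (h : IsType1sq1 a) :
    a ≠ 0 ∧ (rootsOfMult a 1).card = 2 ∧ (rootsOfMult a 2).card = 1 := by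
  classical
  obtain ⟨P, Q, hPQ, hP, hQ⟩ := h
  have ha : a ≠ 0 := ne_zero_of_rootMult_ne_zero (P := P) (by omega)
  refine ⟨ha, Finset.card_eq_two.2 ⟨P, Q, hPQ, Finset.ext fun S => ?_⟩,
    Finset.card_eq_one.2 ⟨P, Finset.ext fun S => ?_⟩⟩
  · rw [mem_rootsOfMult, Finset.mem_insert, Finset.mem_singleton]
    constructor
    · intro hS
      by_contra! h
      have := rootMult_add_add_le ha h.1 h.2 hPQ
      omega
    · rintro (rfl | rfl) <;> omega
  · rw [mem_rootsOfMult, Finset.mem_singleton]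
    constructor
    · intro hS
      by_contra! h
      have := rootMult_add_le ha h
      omega
    · rintro rfl
      omega

theorem IsType111.card {a : Form K} (h : IsType111 a) :
    a ≠ 0 ∧ (rootsOfMult a 1).card = 3 ∧ (rootsOfMult a 2).card = 0 := by
  classical
  obtain ⟨P, Q, R, hPQ, hPR, hQR, hP, hQ, hR⟩ := h
  have ha : a ≠ 0 := ne_zero_of_rootMult_ne_zero (P := P) (by omega)
  have key {S : OnePoint K} (hS : 1 ≤ rootMult a S) : S = P ∨ S = Q ∨ S = R := by
    by_contra! h
    have := rootMult_add_add_add_le ha hPQ hPR hQR h.1 h.2.1 h.2.2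
    omega
  refine ⟨ha, Finset.card_eq_three.2 ⟨P, Q, R, hPQ, hPR, hQR, Finset.ext fun S => ?_⟩,
    Finset.card_eq_zero.2 (Finset.eq_empty_of_forall_notMem fun S hS => ?_)⟩
  · rw [mem_rootsOfMult, Finset.mem_insert, Finset.mem_insert, Finset.mem_singleton]
    refine ⟨key, ?_⟩
    rintro (rfl | rfl | rfl) <;> omega
  · rw [mem_rootsOfMult] at hS
    rcases key (by omega : 1 ≤ rootMult a S) with rfl | rfl | rfl <;> omega

theorem IsType21.card {a : Form K} (h : IsType21 a) :
    a ≠ 0 ∧ (rootsOfMult a 1).card = 1 ∧ (rootsOfMult a 2).card = 0 := by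
  obtain ⟨P, hP, hQ⟩ := h
  have ha : a ≠ 0 := ne_zero_of_rootMult_ne_zero (P := P) (by omega)
  refine ⟨ha, Finset.card_eq_one.2 ⟨P, Finset.ext fun S => ?_⟩,
    Finset.card_eq_zero.2 (Finset.eq_empty_of_forall_notMem fun S hS => ?_)⟩
  · rw [mem_rootsOfMult, Finset.mem_singleton]
    constructor
    · intro hS
      by_contra! h
      have := hQ S h
      omega
    · rintro rfl
      omega
  · rw [mem_rootsOfMult] at hS
    by_cases h : S = P
    · subst h
      omega
    · have := hQ S h
      omega

theorem IsType3.card {a : Form K} (h : IsType3 a) :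
    a ≠ 0 ∧ (rootsOfMult a 1).card = 0 ∧ (rootsOfMult a 2).card = 0 := by
  refine ⟨h.1, Finset.card_eq_zero.2 (Finset.eq_empty_of_forall_notMem fun S hS => ?_),
    Finset.card_eq_zero.2 (Finset.eq_empty_of_forall_notMem fun S hS => ?_)⟩ <;>
  · rw [mem_rootsOfMult, h.2 S] at hS
    omega

end Counting

/-! ### The transform in terms of point counts -/

section Values

variable {p : ℕ} [hp : Fact p.Prime]

-- Since `p x = 0` only depends on `x` modulo `p`, the first and third conditions in
-- `fourier_PhiPrime` both say that `P` is a root of the reduction of `b`. The second says that it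
-- is a multiple root; for zero reduction all of them hold at every point.
open Classical in
theorem fourier_PhiPrime_of_eq_smul (hp3 : p ≠ 3)
    (y : Module.Dual (ZMod (p ^ 2)) (Form (ZMod (p ^ 2)))) (b : Form (ZMod (p ^ 2)))
    (hy : iota y = (p : ZMod (p ^ 2)) • b) :
    (p : ℂ) ^ 8 * fourier (PhiPrime p) y =
      (Finset.univ.filter fun P => localForm (reduce p b) P 3 = 0).card * ((p : ℂ) ^ 5 - p ^ 4)
      + (Finset.univ.filter fun P => localForm (reduce p b) P 2 = 0 ∧
          localForm (reduce p b) P 3 = 0).card * (p : ℂ) ^ 5 - (p : ℂ) ^ 5 := by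
  rw [fourier_PhiPrime hp3, hy, if_pos ⟨b, rfl⟩]
  congr 1
  simp only [atPoint_smul, Pi.smul_apply, smul_eq_mul, p_mul_eq_zero_iff, map_mul, red_p, zero_mul,
    true_and, ← reduce_atPoint, reduce_apply]
  rw [Finset.sum_sub_distrib, Finset.sum_add_distrib]
  simp only [← Finset.sum_filter, Finset.sum_const, nsmul_eq_mul]
  ring

theorem fourier_PhiPrime_of_card (hp3 : p ≠ 3)
    (y : Module.Dual (ZMod (p ^ 2)) (Form (ZMod (p ^ 2)))) (b : Form (ZMod (p ^ 2)))
    (hy : iota y = (p : ZMod (p ^ 2)) • b) {m n : ℕ} (h : reduce p b ≠ 0 ∧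
      (rootsOfMult (reduce p b) 1).card = m ∧ (rootsOfMult (reduce p b) 2).card = n) :
    (p : ℂ) ^ 8 * fourier (PhiPrime p) y =
      m * ((p : ℂ) ^ 5 - p ^ 4) + n * (p : ℂ) ^ 5 - (p : ℂ) ^ 5 := by
  classical
  obtain ⟨h0, rfl, rfl⟩ := h
  rw [fourier_PhiPrime_of_eq_smul hp3 y b hy]
  simp only [rootsOfMult, one_le_rootMult_iff h0, two_le_rootMult_iff h0]

-- The first term of `fourier_PhiPrime` drops out, as its condition at any `P` would force the form
-- into `pV`.
open Classical in
theorem fourier_PhiPrime_of_notMem (hp3 : p ≠ 3)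
    (y : Module.Dual (ZMod (p ^ 2)) (Form (ZMod (p ^ 2)))) (hy : iota y ∉ pForms p) :
    (p : ℂ) ^ 8 * fourier (PhiPrime p) y =
      (Finset.univ.filter fun P : OnePoint (ZMod p) => red p (atPoint P (iota y) 1) = 0 ∧
        atPoint P (iota y) 2 = 0 ∧ atPoint P (iota y) 3 = 0).card * (p : ℂ) ^ 5
      - (Finset.univ.filter fun P : OnePoint (ZMod p) => red p (atPoint P (iota y) 1) = 0 ∧
        red p (atPoint P (iota y) 2) = 0 ∧ atPoint P (iota y) 3 = 0).card * (p : ℂ) ^ 4 := by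
  rw [fourier_PhiPrime hp3, if_neg hy, sub_zero]
  have h (P : OnePoint (ZMod p)) : ¬ (red p (atPoint P (iota y) 0) = 0 ∧
      red p (atPoint P (iota y) 1) = 0 ∧ red p (atPoint P (iota y) 2) = 0 ∧
      atPoint P (iota y) 3 = 0) := fun ⟨h0, h1, h2, h3⟩ =>
    atPoint_ne_zero hy P h1 h2 (by rw [h3, map_zero]) h0
  simp only [h, if_false, zero_add]
  rw [Finset.sum_sub_distrib]
  simp only [← Finset.sum_filter, Finset.sum_const, nsmul_eq_mul]

theorem eq_of_atPoint {b : Form (ZMod (p ^ 2))} (hb : b ∉ pForms p) {P Q : OnePoint (ZMod p)}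
    (hP : red p (atPoint P b 2) = 0 ∧ atPoint P b 3 = 0)
    (hQ : red p (atPoint Q b 2) = 0 ∧ atPoint Q b 3 = 0) : P = Q :=
  eq_of_two_le_rootMult (SingularAt.two_le_rootMult hb ⟨hP.1, Or.inr hP.2⟩)
    (SingularAt.two_le_rootMult hb ⟨hQ.1, Or.inr hQ.2⟩)

end Values

end BinaryCubic

/-! ### Evaluation for each type -/

theorem mainTheorem3 (p : ℕ) [Fact p.Prime] (hp2 : p ≠ 2) (hp3 : p ≠ 3)
    (b : BinaryCubic.Form (ZMod (p ^ 2)))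
    (y : Module.Dual (ZMod (p ^ 2)) (BinaryCubic.Form (ZMod (p ^ 2))))
    (hy : BinaryCubic.iota y = b) :
    (∀ b' : BinaryCubic.Form (ZMod (p ^ 2)), b = (p : ZMod (p ^ 2)) • b' →
      (BinaryCubic.reduce p b' = 0 →
        BinaryCubic.fourier (BinaryCubic.PhiPrime p) y
          = 2 * (p : ℂ) ^ (-2 : ℤ) - (p : ℂ) ^ (-4 : ℤ)) ∧
      (BinaryCubic.IsType1cu (BinaryCubic.reduce p b') →
        BinaryCubic.fourier (BinaryCubic.PhiPrime p) y
          = (p : ℂ) ^ (-3 : ℤ) - (p : ℂ) ^ (-4 : ℤ)) ∧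
      (BinaryCubic.IsType1sq1 (BinaryCubic.reduce p b') →
        BinaryCubic.fourier (BinaryCubic.PhiPrime p) y
          = 2 * (p : ℂ) ^ (-3 : ℤ) - 2 * (p : ℂ) ^ (-4 : ℤ)) ∧
      (BinaryCubic.IsType111 (BinaryCubic.reduce p b') →
        BinaryCubic.fourier (BinaryCubic.PhiPrime p) y
          = 2 * (p : ℂ) ^ (-3 : ℤ) - 3 * (p : ℂ) ^ (-4 : ℤ)) ∧
      (BinaryCubic.IsType21 (BinaryCubic.reduce p b') →
        BinaryCubic.fourier (BinaryCubic.PhiPrime p) y = -(p : ℂ) ^ (-4 : ℤ)) ∧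
      (BinaryCubic.IsType3 (BinaryCubic.reduce p b') →
        BinaryCubic.fourier (BinaryCubic.PhiPrime p) y = -(p : ℂ) ^ (-3 : ℤ))) ∧
    (b ∉ BinaryCubic.pForms p →
      (b ∈ BinaryCubic.type1cuStarStar p →
        BinaryCubic.fourier (BinaryCubic.PhiPrime p) y
          = (p : ℂ) ^ (-3 : ℤ) - (p : ℂ) ^ (-4 : ℤ)) ∧
      (b ∈ BinaryCubic.type1cuStar p →
        BinaryCubic.fourier (BinaryCubic.PhiPrime p) y = -(p : ℂ) ^ (-4 : ℤ)) ∧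
      (b ∉ BinaryCubic.type1cuStarStar p → b ∉ BinaryCubic.type1cuStar p →
        BinaryCubic.fourier (BinaryCubic.PhiPrime p) y = 0)) := by
  classical
  have hp0 : (p : ℂ) ≠ 0 := Nat.cast_ne_zero.2 (Fact.out : p.Prime).ne_zero
  have cancel {x z : ℂ} (h : (p : ℂ) ^ 8 * x = (p : ℂ) ^ 8 * z) : x = z :=
    mul_left_cancel₀ (pow_ne_zero 8 hp0) h
  have h2 : (p : ℂ) ^ 8 * (p : ℂ) ^ (-2 : ℤ) = (p : ℂ) ^ 6 := by
    rw [← zpow_natCast, ← zpow_natCast, ← zpow_add₀ hp0]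
    norm_num
  have h3 : (p : ℂ) ^ 8 * (p : ℂ) ^ (-3 : ℤ) = (p : ℂ) ^ 5 := by
    rw [← zpow_natCast, ← zpow_natCast, ← zpow_add₀ hp0]
    norm_num
  have h4 : (p : ℂ) ^ 8 * (p : ℂ) ^ (-4 : ℤ) = (p : ℂ) ^ 4 := by
    rw [← zpow_natCast, ← zpow_natCast, ← zpow_add₀ hp0]
    norm_num
  subst hy
  refine ⟨fun b' hb' => ⟨fun h => cancel ?_, fun h => cancel ?_, fun h => cancel ?_,
    fun h => cancel ?_, fun h => cancel ?_, fun h => cancel ?_⟩,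
    fun hb => ⟨fun h => cancel ?_, fun h => cancel ?_, fun hs hs' => cancel ?_⟩⟩
  · have hc : (Fintype.card (OnePoint (ZMod p)) : ℂ) = p + 1 := by
      have : Fintype.card (OnePoint (ZMod p)) = p + 1 :=
        (Fintype.card_option (α := ZMod p)).trans (by rw [ZMod.card])
      rw [this, Nat.cast_add, Nat.cast_one]
    have hl (P : OnePoint (ZMod p)) (i : Fin 4) :
        BinaryCubic.localForm (0 : BinaryCubic.Form (ZMod p)) P i = 0 := by
      rcases P with _ | s <;> fin_cases i <;>
        simp [BinaryCubic.localForm, BinaryCubic.rotate, BinaryCubic.shear]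
    rw [BinaryCubic.fourier_PhiPrime_of_eq_smul hp3 y b' hb', h]
    simp only [hl, and_self, Finset.filter_true, Finset.card_univ, hc]
    -- Both counts equal `p + 1`, and `(p + 1) (2 p ^ 5 - p ^ 4) - p ^ 5 = 2 p ^ 6 - p ^ 4`.
    linear_combination -2 * h2 + h4
  · rw [BinaryCubic.fourier_PhiPrime_of_card hp3 y b' hb' h.card]
    push_cast
    linear_combination -h3 + h4
  · rw [BinaryCubic.fourier_PhiPrime_of_card hp3 y b' hb' h.card]
    push_cast
    linear_combination -2 * h3 + 2 * h4
  · rw [BinaryCubic.fourier_PhiPrime_of_card hp3 y b' hb' h.card]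
    push_cast
    linear_combination -2 * h3 + 3 * h4
  · rw [BinaryCubic.fourier_PhiPrime_of_card hp3 y b' hb' h.card]
    push_cast
    linear_combination h4
  · rw [BinaryCubic.fourier_PhiPrime_of_card hp3 y b' hb' h.card]
    push_cast
    linear_combination h3
  · rw [BinaryCubic.fourier_PhiPrime_of_notMem hp3 y hb]
    obtain ⟨P, -, hP1, hP2, hP3⟩ := (BinaryCubic.mem_type1cuStarStar_iff _).1 h
    -- The witness of type `(1³_**)` is the only point in either count, which gives `p ^ 5 - p ^ 4`.
    rw [Finset.card_eq_one.2 ⟨P, ?_⟩, Finset.card_eq_one.2 ⟨P, ?_⟩]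
    · push_cast
      linear_combination -h3 + h4
    · ext Q
      simp only [Finset.mem_filter, Finset.mem_univ, true_and, Finset.mem_singleton]
      constructor
      · rintro ⟨-, hQ⟩
        exact BinaryCubic.eq_of_atPoint hb hQ ⟨by rw [hP2, map_zero], hP3⟩
      · rintro rfl
        exact ⟨hP1, by rw [hP2, map_zero], hP3⟩
    · ext Q
      simp only [Finset.mem_filter, Finset.mem_univ, true_and, Finset.mem_singleton]
      constructor
      · rintro ⟨-, hQ2, hQ3⟩
        exact BinaryCubic.eq_of_atPoint hb ⟨by rw [hQ2, map_zero], hQ3⟩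
          ⟨by rw [hP2, map_zero], hP3⟩
      · rintro rfl
        exact ⟨hP1, hP2, hP3⟩
  · rw [BinaryCubic.fourier_PhiPrime_of_notMem hp3 y hb]
    obtain ⟨P, -, hP1, hP2, hP3⟩ := (BinaryCubic.mem_type1cuStar_iff _).1 h
    -- A point in the first count would coincide with `P`, where coefficient 2 is nonzero, so only
    -- the term `-p ^ 4` survives.
    rw [Finset.card_eq_zero.2 (Finset.eq_empty_of_forall_notMem fun Q hQ => ?_),
      Finset.card_eq_one.2 ⟨P, ?_⟩]
    · push_cast
      linear_combination h4
    · ext Q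
      simp only [Finset.mem_filter, Finset.mem_univ, true_and, Finset.mem_singleton]
      constructor
      · rintro ⟨-, hQ⟩
        exact BinaryCubic.eq_of_atPoint hb hQ ⟨hP2.1, hP3⟩
      · rintro rfl
        exact ⟨hP1, hP2.1, hP3⟩
    · obtain ⟨-, -, hQ2, hQ3⟩ := Finset.mem_filter.1 hQ
      obtain rfl := BinaryCubic.eq_of_atPoint hb ⟨by rw [hQ2, map_zero], hQ3⟩ ⟨hP2.1, hP3⟩
      exact hP2.2 hQ2
  · rw [BinaryCubic.fourier_PhiPrime_of_notMem hp3 y hb]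
    have key (Q : OnePoint (ZMod p)) :
        ¬ (BinaryCubic.red p (BinaryCubic.atPoint Q (BinaryCubic.iota y) 1) = 0 ∧
        BinaryCubic.red p (BinaryCubic.atPoint Q (BinaryCubic.iota y) 2) = 0 ∧
        BinaryCubic.atPoint Q (BinaryCubic.iota y) 3 = 0) := by
      rintro ⟨h1, h2, h3⟩
      have h0 := BinaryCubic.atPoint_ne_zero hb Q h1 h2 (by rw [h3, map_zero])
      by_cases h2' : BinaryCubic.atPoint Q (BinaryCubic.iota y) 2 = 0
      · exact hs ((BinaryCubic.mem_type1cuStarStar_iff _).2 ⟨Q, h0, h1, h2', h3⟩)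
      · exact hs' ((BinaryCubic.mem_type1cuStar_iff _).2 ⟨Q, h0, h1, ⟨h2, h2'⟩, h3⟩)
    rw [Finset.card_eq_zero.2 (Finset.eq_empty_of_forall_notMem fun Q hQ => ?_),
      Finset.card_eq_zero.2 (Finset.eq_empty_of_forall_notMem fun Q hQ => ?_)]
    · simp
    · exact key Q (Finset.mem_filter.1 hQ).2
    · obtain ⟨-, h1, hQ2, hQ3⟩ := Finset.mem_filter.1 hQ
      exact key Q ⟨h1, by rw [hQ2, map_zero], hQ3⟩
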